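/- Let $b\ge 2$ be an integer and let $\Gamma$ be the homogeneous rooted metric tree with branching number $b$ and edge length $1$: exactly one edge emanates from the root $o$, exactly $b$ edges emanate (away from the root) from every other vertex, and every edge has length $1$. Write $|x|$ for the distance of $x$ to $o$, $dx$ for the arc-length measure, $u'$ for the derivative along the edges, and put $\Gamma_o=\Gamma\cup\{o\}$. Let $C_0^\infty(\Gamma_o)$ be the set of continuous functions $u:\Gamma_o\to\mathbb{C}$ that are infinitely smooth on every closed edge and have bounded support; they need not vanish at $o$. Put $$R_b=\frac{b^{1/2}+b^{-1/2}}{2},\qquad \lambda_b=\Big(\arccos\frac1{R_b}\Big)^2 .$$ Let $\psi:(0,\infty)\to[0,\infty)$ be measurable. Then there is a constant $C=C(b,\psi)\in(0,\infty)$ with $$\int_\Gamma \psi(|x|)\,|u(x)|^2\,dx\;\le\; C\int_\Gamma\big(|u'(x)|^2-\lambda_b|u(x)|^2\big)\,dx\qquad\text{for all }u\in C_0^\infty(\Gamma_o)$$ (the left-hand side being, in particular, finite) if and only if $$\sup_{r>0}\,(1+r)^{-1}\int_0^r\psi(t)(1+t)^2\,dt<\infty .$$ -/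

import Mathlib

open MeasureTheory Set
open scoped ContDiff ENNReal

noncomputable section

/-- The edges of the homogeneous metric tree with branching number `b`, coded by words over `Fin b`.
The empty word is the unique edge emanating from the root, and the `b` edges emanating from the
terminal vertex of the edge `w` are the edges `i :: w`, where `i : Fin b`. All edges have length `1`. -/
abbrev TreeEdge (b : ℕ) : Type := List (Fin b)

/-- The set `Γ ∪ {o}` of points of the homogeneous metric tree with branching number `b` and edge
length `1`: the root `o`, and for every edge `w` and every `s ∈ (0, 1]` the point of `w` that
has distance `s` to the initial vertex of `w`; `s = 1` is the terminal vertex of `w`. -/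
inductive HomTree (b : ℕ) : Type
  | root : HomTree b
  | pt (w : TreeEdge b) (s : Ioc (0 : ℝ) 1) : HomTree b

namespace HomTree

variable {b : ℕ}

/-- The distance `|x|` from `x` to the root: the path from the root to the point `s` of the
edge `w` runs through `w.length` full edges and then through a segment of length `s` of `w`. -/
def height : HomTree b → ℝ
  | root => 0
  | pt w s => w.length + s

/-- The terminal vertex of an edge. -/
def terminal (w : TreeEdge b) : HomTree b := pt w ⟨1, by norm_num, le_rfl⟩

/-- The initial vertex of an edge: the root for the first edge, and the terminal vertex of `w` for
the edges `i :: w`. -/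
def initial : TreeEdge b → HomTree b
  | [] => root
  | _ :: w => terminal w

/-- The arc-length parametrization `[0, 1] → Γ ∪ {o}` of the closed edge `w`, from its initial
vertex to its terminal vertex (extended to the line by constants). -/
def edge (w : TreeEdge b) (s : ℝ) : HomTree b :=
  if h : 0 < s then pt w ⟨min s 1, lt_min h one_pos, min_le_right s 1⟩ else initial w

/-- The Borel sets of the tree: the sets whose trace on every edge is Borel. -/
instance : MeasurableSpace (HomTree b) :=
  ⨅ w : TreeEdge b, MeasurableSpace.map (edge w) inferInstance

/-- The arc-length measure `dx` on the tree: the sum over the edges of Lebesgue measure. -/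
def arcLength (b : ℕ) : Measure (HomTree b) :=
  Measure.sum fun w : TreeEdge b => (volume.restrict (Ioc (0 : ℝ) 1)).map (edge w)

/-- The derivative `u'` along the edges, in the direction away from the root (at the terminal
vertex of an edge, the one-sided derivative on this edge). -/
def edgeDeriv (u : HomTree b → ℂ) : HomTree b → ℂ
  | root => derivWithin (fun t => u (edge [] t)) (Icc 0 1) 0
  | pt w s => derivWithin (fun t => u (edge w t)) (Icc 0 1) s

/-- The class `C_0^∞(Γ ∪ {o})`: functions on the tree that are smooth on every closed edge and
vanish outside a bounded set. As adjacent edges share their common vertex as a point of the tree,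
such functions are continuous on the tree. They need not vanish at the root. -/
def SmoothBoundedSupport (u : HomTree b → ℂ) : Prop :=
  (∀ w : TreeEdge b, ContDiffOn ℝ ∞ (fun t => u (edge w t)) (Icc 0 1)) ∧
    ∃ R : ℝ, ∀ x : HomTree b, R < x.height → u x = 0

theorem height_edge (w : TreeEdge b) {s : ℝ} (hs : s ∈ Icc (0 : ℝ) 1) :
    (edge w s).height = w.length + s := by
  unfold edge
  split_ifs with h
  · simp [height, hs.2]
  · have : s = 0 := le_antisymm (not_lt.mp h) hs.1
    subst this
    cases w <;> simp [initial, terminal, height]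

theorem measurable_edge (w : TreeEdge b) : Measurable (edge w) :=
  measurable_iff_le_map.mpr (iInf_le _ w)

end HomTree

/-- `R_b = (b^{1/2} + b^{-1/2}) / 2`. -/
def Rb (b : ℕ) : ℝ := ((b : ℝ) ^ (1 / 2 : ℝ) + (b : ℝ) ^ (-(1 / 2) : ℝ)) / 2

/-- `λ_b = (arccos (1 / R_b))²`. -/
def lambdaB (b : ℕ) : ℝ := Real.arccos (1 / Rb b) ^ 2

end

/-! Put θ = arccos (1 / R_b), so (1 + b) cos θ = 2√b. On radial solutions of u'' = -θ² u with vertex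
values a_j b^(-j/2), the Kirchhoff condition becomes a_{j-1} + a_{j+1} = 2 a_j. The characteristic
equation thus has a double root, affine sequences are solutions, and the linearly growing ground
state accounts for the weight (1 + t)².

Sufficiency: on each edge let p be the ground state and σ = p'/p - k/p². If V p² + k²/p² ≤ k', then
σ' + σ² + θ² + V ≤ 0, and completing a square bounds the energy minus V below by the boundary values
of σ|u|² (`boundary_le_integral_of_riccati`). The choice k(t) = δ ∫₀ᵗ ψ(τ)(1 + τ)² dτ + εt works
because the hypothesis makes k grow linearly while p² grows quadratically. By
`ground_state_slope_matching` the boundary terms telescope over the tree (`sum_boundary_eq`): those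
at the far end vanish, the one at the root has the right sign.

Necessity: the energy of a radial interpolation is a multiple of ∑ (a_j - a_{j+1})² + (b - 1)/(b +
1) a_0² (`integral_energy_radialInterp`). A tent of height n + 1 has energy O(n), yet after
multiplication by b^(j/2) it dominates a multiple of 1 + t up to height n (`lintegral_le_of_hardy`).
-/

namespace HomTree

/-! ### Levels, measurability and integration on the tree. -/

variable {b : ℕ}

/-- The edges at combinatorial distance `j` from the root. -/
noncomputable def level (b j : ℕ) : Finset (TreeEdge b) :=
  (List.finite_length_eq (Fin b) j).toFinset

theorem mem_level {j : ℕ} {w : TreeEdge b} : w ∈ level b j ↔ w.length = j := by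
  simp [level]

theorem level_zero : level b 0 = {[]} := by
  ext w; simp [mem_level]

theorem sum_level_succ {M : Type*} [AddCommMonoid M] (j : ℕ) (g : TreeEdge b → M) :
    ∑ w ∈ level b (j + 1), g w = ∑ w ∈ level b j, ∑ i : Fin b, g (i :: w) := by
  rw [← Finset.sum_product']
  symm
  refine Finset.sum_bij (fun x _ => x.2 :: x.1) ?_ ?_ ?_ ?_
  · rintro ⟨w, i⟩ h
    simp [mem_level] at h ⊢
    exact h
  · rintro ⟨w, i⟩ _ ⟨w', i'⟩ _ h
    simp at h
    simp [h]
  · intro w h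
    cases w with
    | nil => simp [mem_level] at h
    | cons i w => exact ⟨(w, i), by simpa [mem_level] using h, rfl⟩
  · simp

theorem card_level (j : ℕ) : (level b j).card = b ^ j := by
  induction j with
  | zero => simp [level_zero]
  | succ j ih =>
    rw [Finset.card_eq_sum_ones, sum_level_succ]
    simp [ih, pow_succ]

theorem edge_of_mem (w : TreeEdge b) {s : ℝ} (hs : s ∈ Ioc (0 : ℝ) 1) :
    edge w s = pt w ⟨s, hs⟩ := by
  simp [edge, hs.1, hs.2]

theorem edge_zero (w : TreeEdge b) : edge w 0 = initial w := by simp [edge]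

theorem edge_one (w : TreeEdge b) : edge w 1 = terminal w := by
  rw [edge_of_mem w ⟨one_pos, le_rfl⟩]; rfl

theorem edge_projIcc (w : TreeEdge b) (s : ℝ) :
    edge w s = edge w (projIcc (0 : ℝ) 1 zero_le_one s) := by
  rcases le_or_gt s 0 with h | h
  · rw [projIcc_of_le_left _ h]
    simp [edge, h.not_gt]
  · rcases le_or_gt s 1 with h1 | h1
    · rw [projIcc_of_mem _ ⟨h.le, h1⟩]
    · rw [projIcc_of_right_le _ h1.le]
      simp [edge, h, h1.le]

theorem measurable_of_edge {β : Type*} [MeasurableSpace β] {f : HomTree b → β}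
    (h : ∀ w, Measurable fun s => f (edge w s)) : Measurable f := by
  intro S hS
  rw [MeasurableSpace.measurableSet_iInf]
  exact fun w => h w hS

theorem measurable_of_continuousOn_edge {u : HomTree b → ℂ}
    (h : ∀ w, ContinuousOn (fun s => u (edge w s)) (Icc 0 1)) : Measurable u := by
  refine measurable_of_edge fun w => ?_
  have : (fun s => u (edge w s)) =
      (fun s : Icc (0 : ℝ) 1 => u (edge w s)) ∘ projIcc (0 : ℝ) 1 zero_le_one := by
    funext s
    simp only [Function.comp]
    rw [edge_projIcc]
  rw [this]
  exact ((continuousOn_iff_continuous_domRestrict.mp (h w)).comp continuous_projIcc).measurable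

theorem measurable_height : Measurable (height : HomTree b → ℝ) := by
  refine measurable_of_edge fun w => ?_
  have : (fun s => height (edge w s)) =
      fun s => w.length + ((projIcc (0 : ℝ) 1 zero_le_one s : Icc (0 : ℝ) 1) : ℝ) := by
    funext s
    rw [edge_projIcc, height_edge w (projIcc (0 : ℝ) 1 zero_le_one s).2]
  rw [this]
  exact (continuous_const.add (continuous_subtype_val.comp continuous_projIcc)).measurable

theorem edgeDeriv_edge (u : HomTree b → ℂ) (w : TreeEdge b) {s : ℝ} (hs : s ∈ Ioc (0 : ℝ) 1) :
    edgeDeriv u (edge w s) = derivWithin (fun t => u (edge w t)) (Icc 0 1) s := by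
  rw [edge_of_mem w hs, edgeDeriv]

theorem measurable_edgeDeriv {u : HomTree b → ℂ}
    (h : ∀ w, ContDiffOn ℝ 1 (fun s => u (edge w s)) (Icc 0 1)) : Measurable (edgeDeriv u) := by
  refine measurable_of_edge fun w => ?_
  -- For `s ≤ 0` the point is the initial vertex of `w`, where `edgeDeriv` refers to the preceding
  -- edge; hence the case split.
  have : (fun s => edgeDeriv u (edge w s)) = fun s => if s ≤ 0 then edgeDeriv u (initial w) else
      derivWithin (fun t => u (edge w t)) (Icc 0 1) (projIcc (0 : ℝ) 1 zero_le_one s) := by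
    funext s
    split_ifs with hs
    · simp [edge, hs.not_gt]
    · rw [edge_projIcc]
      refine edgeDeriv_edge u w ⟨?_, (projIcc (0 : ℝ) 1 zero_le_one s).2.2⟩
      rw [coe_projIcc]
      simpa using hs
  rw [this]
  refine Measurable.ite measurableSet_Iic measurable_const ?_
  exact ((continuousOn_iff_continuous_domRestrict.mp
    ((h w).continuousOn_derivWithin (uniqueDiffOn_Icc one_pos) le_rfl)).comp
    continuous_projIcc).measurable

theorem ae_arcLength {P : HomTree b → Prop} (hP : MeasurableSet {x | P x})
    (h : ∀ w, ∀ s ∈ Ioc (0 : ℝ) 1, P (edge w s)) : ∀ᵐ x ∂arcLength b, P x := by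
  rw [arcLength, Measure.ae_sum_iff' hP]
  intro w
  rw [ae_map_iff (measurable_edge w).aemeasurable hP]
  exact (ae_restrict_iff' measurableSet_Ioc).mpr (ae_of_all _ (h w))

theorem integral_arcLength {f : HomTree b → ℝ} (hf : Measurable f) (N : ℕ)
    (h0 : ∀ w : TreeEdge b, N ≤ w.length → ∀ s ∈ Ioc (0 : ℝ) 1, f (edge w s) = 0)
    (hi : ∀ w : TreeEdge b, IntervalIntegrable (fun s => f (edge w s)) volume 0 1) :
    Integrable f (arcLength b) ∧ ∫ x, f x ∂arcLength b =
      ∑ j ∈ Finset.range N, ∑ w ∈ level b j, ∫ s in (0 : ℝ)..1, f (edge w s) := by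
  have hsupp : ∀ w ∉ (Finset.range N).biUnion (level b), ∀ s ∈ Ioc (0 : ℝ) 1,
      f (edge w s) = 0 := by
    intro w hw
    exact h0 w (by simpa [mem_level] using hw)
  have hint : Integrable f (arcLength b) := by
    refine integrable_sum_measure (fun w => ?_) ?_
    · rw [integrable_map_measure hf.aestronglyMeasurable (measurable_edge w).aemeasurable]
      exact (intervalIntegrable_iff_integrableOn_Ioc_of_le zero_le_one).mp (hi w)
    · refine summable_of_ne_finset_zero (s := (Finset.range N).biUnion (level b)) fun w hw => ?_
      rw [integral_map (measurable_edge w).aemeasurable hf.norm.aestronglyMeasurable]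
      exact setIntegral_eq_zero_of_forall_eq_zero fun s hs => by simp [hsupp w hw s hs]
  refine ⟨hint, ?_⟩
  have hw : ∀ w, ∫ x, f x ∂((volume.restrict (Ioc (0 : ℝ) 1)).map (edge w)) =
      ∫ s in (0 : ℝ)..1, f (edge w s) := fun w => by
    rw [integral_map (measurable_edge w).aemeasurable hf.aestronglyMeasurable,
      intervalIntegral.integral_of_le zero_le_one]
  rw [arcLength, integral_sum_measure hint]
  simp_rw [hw]
  rw [tsum_eq_sum (s := (Finset.range N).biUnion (level b)), Finset.sum_biUnion]
  · intro i _ j _ hij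
    refine Finset.disjoint_left.mpr fun w hi hj => hij ?_
    rw [← mem_level.mp hi, mem_level.mp hj]
  · intro w hw'
    rw [intervalIntegral.integral_of_le zero_le_one]
    exact setIntegral_eq_zero_of_forall_eq_zero (hsupp w hw')

/-- Discarding the higher levels is enough for the lower bound on the potential term in the
necessity part. -/
theorem sum_lintegral_le_lintegral_arcLength {f : HomTree b → ℝ≥0∞} (hf : Measurable f) (n : ℕ) :
    ∑ j ∈ Finset.range n, ∑ w ∈ level b j, ∫⁻ s in Ioc (0 : ℝ) 1, f (edge w s) ≤
      ∫⁻ x, f x ∂arcLength b := by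
  rw [arcLength, lintegral_sum_measure, ← Finset.sum_biUnion]
  · refine le_trans (le_of_eq (Finset.sum_congr rfl fun w _ => ?_)) (ENNReal.sum_le_tsum _)
    rw [lintegral_map hf (measurable_edge w)]
  · intro i _ j _ hij
    refine Finset.disjoint_left.mpr fun w hi hj => hij ?_
    rw [← mem_level.mp hi, mem_level.mp hj]

end HomTree

/-! ### The Riccati inequality on one edge. -/

theorem hasDerivAt_derivWithin_Icc {f : ℝ → ℂ} (hf : ContDiffOn ℝ 1 f (Icc 0 1)) {s : ℝ}
    (hs : s ∈ Ioo (0 : ℝ) 1) : HasDerivAt f (derivWithin f (Icc 0 1) s) s :=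
  ((hf.differentiableOn one_ne_zero) s (Ioo_subset_Icc_self hs)).hasDerivWithinAt.hasDerivAt
    (Icc_mem_nhds hs.1 hs.2)

theorem continuousOn_derivWithin_Icc {f : ℝ → ℂ} (hf : ContDiffOn ℝ 1 f (Icc 0 1)) :
    ContinuousOn (derivWithin f (Icc 0 1)) (Icc 0 1) :=
  hf.continuousOn_derivWithin (uniqueDiffOn_Icc one_pos) le_rfl

/-- Hardy-type inequality on an interval, from a positive solution `p` of `p'' = -θ² p` and a
primitive `K` of `G` with `V p² + K² / p² ≤ G`. -/
theorem boundary_le_integral_of_riccati {f : ℝ → ℂ} (hf : ContDiffOn ℝ 1 f (Icc 0 1))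
    {p p' : ℝ → ℝ} {θ : ℝ} (hp : ∀ s, HasDerivAt p (p' s) s)
    (hp' : ∀ s, HasDerivAt p' (-θ ^ 2 * p s) s) (hpos : ∀ s ∈ Icc (0 : ℝ) 1, 0 < p s)
    {G V K : ℝ → ℝ} {K₀ : ℝ} (hG : IntervalIntegrable G volume 0 1)
    (hV : IntervalIntegrable V volume 0 1)
    (hK : ∀ s ∈ Icc (0 : ℝ) 1, K s = K₀ + ∫ t in (0 : ℝ)..s, G t)
    (hle : ∀ s ∈ Ioo (0 : ℝ) 1, V s * p s ^ 2 + K s ^ 2 / p s ^ 2 ≤ G s) :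
    (p' 1 / p 1 - K 1 / p 1 ^ 2) * ‖f 1‖ ^ 2 - (p' 0 / p 0 - K 0 / p 0 ^ 2) * ‖f 0‖ ^ 2 ≤
      ∫ s in (0 : ℝ)..1, (‖derivWithin f (Icc 0 1) s‖ ^ 2 - θ ^ 2 * ‖f s‖ ^ 2
        - V s * ‖f s‖ ^ 2) := by
  have hu : uIcc (0 : ℝ) 1 = Icc 0 1 := uIcc_of_le zero_le_one
  have hpc : Continuous p := continuous_iff_continuousAt.mpr fun s => (hp s).continuousAt
  have hpc' : Continuous p' := continuous_iff_continuousAt.mpr fun s => (hp' s).continuousAt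
  have hp1 : ContDiff ℝ 1 p := by
    rw [contDiff_one_iff_deriv]
    refine ⟨fun s => (hp s).differentiableAt, ?_⟩
    rwa [show deriv p = p' from funext fun s => (hp s).deriv]
  have hp1' : ContDiff ℝ 1 p' := by
    rw [contDiff_one_iff_deriv]
    refine ⟨fun s => (hp' s).differentiableAt, ?_⟩
    rw [show deriv p' = fun s => -θ ^ 2 * p s from funext fun s => (hp' s).deriv]
    exact continuous_const.mul hpc
  -- With σ = p'/p - K/p², the product `A * B` is σ‖f‖². All the roughness of `G` sits in `A`, which
  -- is only absolutely continuous; `B` is C¹.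
  set A : ℝ → ℝ := fun s => p' s * p s - (K₀ + ∫ t in (0 : ℝ)..s, G t) with hA
  set B : ℝ → ℝ := fun s => ‖f s‖ ^ 2 / p s ^ 2 with hB
  have hAac : AbsolutelyContinuousOnInterval A 0 1 := by
    have h1 : AbsolutelyContinuousOnInterval (fun s => p' s * p s - K₀) 0 1 :=
      ((hp1'.mul hp1).sub contDiff_const).contDiffOn.absolutelyContinuousOnInterval
    have h2 := h1.sub (hG.absolutelyContinuousOnInterval_intervalIntegral (c := 0) (by simp))
    have h3 : A = (fun s => p' s * p s - K₀) - fun s => ∫ t in (0 : ℝ)..s, G t := by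
      funext s
      simp only [hA, Pi.sub_apply]
      ring
    rw [h3]
    exact h2
  have hB1 : ContDiffOn ℝ 1 B (Icc 0 1) :=
    (hf.norm_sq ℝ).div (hp1.contDiffOn.pow 2) fun s hs => (pow_pos (hpos s hs) 2).ne'
  have hBac : AbsolutelyContinuousOnInterval B 0 1 := by
    refine ContDiffOn.absolutelyContinuousOnInterval ?_
    rwa [hu]
  have key := hAac.integral_deriv_mul_eq_sub hBac
  have e : ∀ s ∈ Icc (0 : ℝ) 1, A s * B s = (p' s / p s - K s / p s ^ 2) * ‖f s‖ ^ 2 := by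
    intro s hs
    have := (hpos s hs).ne'
    simp only [hA, hB]
    rw [← hK s hs]
    field_simp
  rw [e 1 (by simp), e 0 (by simp)] at key
  rw [← key]
  refine intervalIntegral.integral_mono_ae_restrict zero_le_one ?_ ?_ ?_
  · exact (hAac.intervalIntegrable_deriv.mul_continuousOn hBac.continuousOn).add
      (hBac.intervalIntegrable_deriv.continuousOn_mul hAac.continuousOn)
  · have hfc := hf.continuousOn
    have hfc' := continuousOn_derivWithin_Icc hf
    refine IntervalIntegrable.sub ?_ ?_
    · refine ContinuousOn.intervalIntegrable ?_
      rw [hu]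
      exact (hfc'.norm.pow 2).sub (continuousOn_const.mul (hfc.norm.pow 2))
    · refine hV.mul_continuousOn ?_
      rw [hu]
      exact hfc.norm.pow 2
  · rw [Filter.EventuallyLE, ← restrict_Ioo_eq_restrict_Icc, ae_restrict_iff' measurableSet_Ioo]
    filter_upwards [hG.ae_hasDerivAt_integral] with s hs hs'
    have hsI := Ioo_subset_Icc_self hs'
    have hp0 := hpos s hsI
    have dA : HasDerivAt A (-θ ^ 2 * p s * p s + p' s * p' s - G s) s := by
      have := ((hp' s).mul (hp s)).sub ((hs (hu ▸ hsI) 0 (by simp)).const_add K₀)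
      exact this
    have df := hasDerivAt_derivWithin_Icc hf hs'
    set f' := derivWithin f (Icc 0 1) s
    have dB : HasDerivAt B ((2 * inner ℝ (f s) f' * p s ^ 2 - ‖f s‖ ^ 2 * (2 * p s * p' s))
        / (p s ^ 2) ^ 2) s := by
      have h2 : HasDerivAt (fun s => p s ^ 2) (2 * p s * p' s) s := by
        simpa using (hp s).fun_pow 2
      exact df.norm_sq.div h2 (pow_pos hp0 2).ne'
    rw [dA.deriv, dB.deriv]
    simp only [hA, hB]
    rw [← hK s hsI]
    -- The right integrand minus (AB)' equals ‖f' - σf‖² + (G - V p² - K²/p²) ‖f‖²/p²; both terms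
    -- are nonnegative.
    have hsq := norm_sub_sq_real f' ((p' s / p s - K s / p s ^ 2) • f s)
    rw [norm_smul, mul_pow, Real.norm_eq_abs, sq_abs, inner_smul_right,
      real_inner_comm] at hsq
    have h0 : 0 ≤ ‖f' - (p' s / p s - K s / p s ^ 2) • f s‖ ^ 2 := by positivity
    rw [hsq] at h0
    have h1 : 0 ≤ (G s - (V s * p s ^ 2 + K s ^ 2 / p s ^ 2)) * (‖f s‖ ^ 2 / p s ^ 2) :=
      mul_nonneg (sub_nonneg.mpr (hle s hs')) (by positivity)
    refine le_of_sub_nonneg (le_trans (add_nonneg h0 h1) (le_of_eq ?_))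
    field_simp
    ring

/-! ### The critical angle. -/

theorem one_div_Rb {b : ℕ} (hb : 2 ≤ b) : 1 / Rb b = 2 * √b / (b + 1) := by
  have hb0 : (0 : ℝ) < b := by positivity
  have hs : 0 < √(b : ℝ) := Real.sqrt_pos.mpr hb0
  have hq : √(b : ℝ) ^ 2 = b := Real.sq_sqrt hb0.le
  rw [Rb, Real.rpow_neg hb0.le, ← Real.sqrt_eq_rpow]
  field_simp
  rw [hq]

theorem one_div_Rb_lt_one {b : ℕ} (hb : 2 ≤ b) : 1 / Rb b < 1 := by
  have hb2 : (2 : ℝ) ≤ b := by exact_mod_cast hb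
  have hq : √(b : ℝ) ^ 2 = b := Real.sq_sqrt (by positivity)
  rw [one_div_Rb hb, div_lt_one (by positivity)]
  have : 1 < √(b : ℝ) := by
    rw [Real.lt_sqrt one_pos.le]
    linarith
  nlinarith

theorem cos_arccos_Rb {b : ℕ} (hb : 2 ≤ b) :
    Real.cos (Real.arccos (1 / Rb b)) = 2 * √b / (b + 1) := by
  rw [Real.cos_arccos _ (one_div_Rb_lt_one hb).le, one_div_Rb hb]
  refine le_trans (by norm_num) (b := 0) ?_
  rw [one_div_Rb hb]
  positivity

theorem arccos_Rb_nonneg (b : ℕ) : 0 ≤ Real.arccos (1 / Rb b) := Real.arccos_nonneg _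

theorem arccos_Rb_le {b : ℕ} (hb : 2 ≤ b) : Real.arccos (1 / Rb b) ≤ Real.pi / 2 := by
  rw [Real.arccos_le_pi_div_two, one_div_Rb hb]
  positivity

theorem sin_arccos_Rb_pos {b : ℕ} (hb : 2 ≤ b) : 0 < Real.sin (Real.arccos (1 / Rb b)) := by
  refine Real.sin_pos_of_pos_of_lt_pi (Real.arccos_pos.mpr (one_div_Rb_lt_one hb)) ?_
  linarith [arccos_Rb_le hb, Real.pi_pos]

/-! ### Solutions on an edge with prescribed end values. -/

/-- The solution of `p'' = -θ² p` with `p 0 = α sin θ` and `p 1 = β sin θ`. -/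
noncomputable def sineInterp (θ α β s : ℝ) : ℝ :=
  α * Real.sin (θ * (1 - s)) + β * Real.sin (θ * s)

/-- The derivative of `sineInterp`. -/
noncomputable def sineInterpDeriv (θ α β s : ℝ) : ℝ :=
  θ * (β * Real.cos (θ * s) - α * Real.cos (θ * (1 - s)))

section SineInterp

variable (θ α β : ℝ)

theorem hasDerivAt_sineInterp (s : ℝ) :
    HasDerivAt (sineInterp θ α β) (sineInterpDeriv θ α β s) s := by
  have h1 : HasDerivAt (fun s : ℝ => θ * (1 - s)) (-θ) s := by
    simpa using ((hasDerivAt_id s).const_sub 1).const_mul θ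
  have h2 : HasDerivAt (fun s : ℝ => θ * s) θ s := by
    simpa using (hasDerivAt_id s).const_mul θ
  refine ((h1.sin.const_mul α).add (h2.sin.const_mul β)).congr_deriv ?_
  simp only [sineInterpDeriv]
  ring

theorem hasDerivAt_sineInterpDeriv (s : ℝ) :
    HasDerivAt (sineInterpDeriv θ α β) (-θ ^ 2 * sineInterp θ α β s) s := by
  have h1 : HasDerivAt (fun s : ℝ => θ * (1 - s)) (-θ) s := by
    simpa using ((hasDerivAt_id s).const_sub 1).const_mul θ
  have h2 : HasDerivAt (fun s : ℝ => θ * s) θ s := by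
    simpa using (hasDerivAt_id s).const_mul θ
  refine (((h2.cos.const_mul β).sub (h1.cos.const_mul α)).const_mul θ).congr_deriv ?_
  simp only [sineInterp]
  ring

theorem contDiff_sineInterp {n : WithTop ℕ∞} : ContDiff ℝ n (sineInterp θ α β) := by
  unfold sineInterp
  fun_prop

@[simp] theorem sineInterp_zero : sineInterp θ α β 0 = α * Real.sin θ := by simp [sineInterp]

@[simp] theorem sineInterp_one : sineInterp θ α β 1 = β * Real.sin θ := by simp [sineInterp]

@[simp] theorem sineInterpDeriv_zero :
    sineInterpDeriv θ α β 0 = θ * (β - α * Real.cos θ) := by simp [sineInterpDeriv]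

@[simp] theorem sineInterpDeriv_one :
    sineInterpDeriv θ α β 1 = θ * (β * Real.cos θ - α) := by simp [sineInterpDeriv]

variable {θ α β}

/-- Both sines are nonnegative, and the addition formula with cos ≤ 1 makes sine subadditive here:
sin θ ≤ sin (θ(1 - s)) + sin (θs). -/
theorem mul_sin_le_sineInterp (h0 : 0 ≤ θ) (h1 : θ ≤ Real.pi / 2) {c : ℝ} (hc : 0 ≤ c)
    (hα : c ≤ α) (hβ : c ≤ β) {s : ℝ} (hs : s ∈ Icc (0 : ℝ) 1) :
    c * Real.sin θ ≤ sineInterp θ α β s := by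
  have hpi := Real.pi_pos
  have hx : 0 ≤ Real.sin (θ * (1 - s)) := Real.sin_nonneg_of_nonneg_of_le_pi
    (mul_nonneg h0 (by linarith [hs.2])) (by nlinarith [hs.1, hs.2])
  have hy : 0 ≤ Real.sin (θ * s) := Real.sin_nonneg_of_nonneg_of_le_pi
    (mul_nonneg h0 hs.1) (by nlinarith [hs.1, hs.2])
  have h : Real.sin θ ≤ Real.sin (θ * (1 - s)) + Real.sin (θ * s) := by
    have e : θ = θ * (1 - s) + θ * s := by ring
    conv_lhs => rw [e, Real.sin_add]
    nlinarith [mul_le_mul_of_nonneg_left (Real.cos_le_one (θ * s)) hx,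
      mul_le_mul_of_nonneg_right (Real.cos_le_one (θ * (1 - s))) hy]
  unfold sineInterp
  nlinarith [mul_le_mul_of_nonneg_left h hc, mul_le_mul_of_nonneg_right hα hx,
    mul_le_mul_of_nonneg_right hβ hy]

theorem sineInterp_le (hα : 0 ≤ α) (hβ : 0 ≤ β) (s : ℝ) : sineInterp θ α β s ≤ α + β := by
  unfold sineInterp
  nlinarith [mul_le_mul_of_nonneg_left (Real.sin_le_one (θ * (1 - s))) hα,
    mul_le_mul_of_nonneg_left (Real.sin_le_one (θ * s)) hβ]

end SineInterp

/-! ### Energy and potential as finite sums over edges. -/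

namespace HomTree

variable {b : ℕ}

theorem SmoothBoundedSupport.contDiffOn {u : HomTree b → ℂ} (hu : SmoothBoundedSupport u)
    (w : TreeEdge b) : ContDiffOn ℝ 1 (fun t => u (edge w t)) (Icc 0 1) :=
  (hu.1 w).of_le (by exact_mod_cast le_top)

theorem SmoothBoundedSupport.measurable {u : HomTree b → ℂ} (hu : SmoothBoundedSupport u) :
    Measurable u :=
  measurable_of_continuousOn_edge fun w => (hu.1 w).continuousOn

theorem SmoothBoundedSupport.exists_level {u : HomTree b → ℂ} (hu : SmoothBoundedSupport u) :
    ∃ N : ℕ, ∀ w : TreeEdge b, N ≤ w.length → ∀ s ∈ Icc (0 : ℝ) 1, u (edge w s) = 0 := by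
  obtain ⟨R, hR⟩ := hu.2
  obtain ⟨N, hN⟩ := exists_nat_gt R
  refine ⟨N, fun w hw s hs => hR _ ?_⟩
  rw [height_edge w hs]
  have : (N : ℝ) ≤ w.length := by exact_mod_cast hw
  linarith [hs.1]

theorem SmoothBoundedSupport.integral_energy {u : HomTree b → ℂ} (hu : SmoothBoundedSupport u)
    {N : ℕ} (hN : ∀ w : TreeEdge b, N ≤ w.length → ∀ s ∈ Icc (0 : ℝ) 1, u (edge w s) = 0)
    (c : ℝ) :
    ∫ x, (‖edgeDeriv u x‖ ^ 2 - c * ‖u x‖ ^ 2) ∂arcLength b =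
      ∑ j ∈ Finset.range N, ∑ w ∈ level b j, ∫ s in (0 : ℝ)..1,
        (‖derivWithin (fun t => u (edge w t)) (Icc 0 1) s‖ ^ 2 - c * ‖u (edge w s)‖ ^ 2) := by
  have hcongr : ∀ w : TreeEdge b, ∀ s ∈ Ioc (0 : ℝ) 1,
      ‖edgeDeriv u (edge w s)‖ ^ 2 - c * ‖u (edge w s)‖ ^ 2 =
      ‖derivWithin (fun t => u (edge w t)) (Icc 0 1) s‖ ^ 2 - c * ‖u (edge w s)‖ ^ 2 :=
    fun w s hs => by rw [edgeDeriv_edge u w hs]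
  rw [(integral_arcLength (f := fun x => ‖edgeDeriv u x‖ ^ 2 - c * ‖u x‖ ^ 2) ?_ N ?_ ?_).2]
  · refine Finset.sum_congr rfl fun j _ => Finset.sum_congr rfl fun w _ => ?_
    rw [intervalIntegral.integral_of_le zero_le_one, intervalIntegral.integral_of_le zero_le_one]
    exact setIntegral_congr_fun measurableSet_Ioc (hcongr w)
  · exact ((measurable_edgeDeriv hu.contDiffOn).norm.pow_const 2).sub
      ((hu.measurable.norm.pow_const 2).const_mul c)
  · intro w hw s hs
    have hs' := Ioc_subset_Icc_self hs
    rw [hcongr w s hs, derivWithin_congr (hN w hw) (hN w hw s hs'), hN w hw s hs']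
    simp
  · intro w
    have h : ContinuousOn (fun s => ‖derivWithin (fun t => u (edge w t)) (Icc 0 1) s‖ ^ 2
        - c * ‖u (edge w s)‖ ^ 2) (Icc 0 1) :=
      ((continuousOn_derivWithin_Icc (hu.contDiffOn w)).norm.pow 2).sub
        (continuousOn_const.mul ((hu.contDiffOn w).continuousOn.norm.pow 2))
    rw [intervalIntegrable_iff_integrableOn_Ioc_of_le zero_le_one]
    exact (h.integrableOn_Icc.mono_set Ioc_subset_Icc_self).congr_fun
      (fun s hs => (hcongr w s hs).symm) measurableSet_Ioc

theorem SmoothBoundedSupport.integral_potential {u : HomTree b → ℂ}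
    (hu : SmoothBoundedSupport u) {N : ℕ}
    (hN : ∀ w : TreeEdge b, N ≤ w.length → ∀ s ∈ Icc (0 : ℝ) 1, u (edge w s) = 0)
    {Ψ : ℝ → ℝ} (hΨm : Measurable Ψ)
    (hΨ : ∀ j : ℕ, IntervalIntegrable (fun s => Ψ (j + s)) volume 0 1) :
    Integrable (fun x => Ψ x.height * ‖u x‖ ^ 2) (arcLength b) ∧
    ∫ x, Ψ x.height * ‖u x‖ ^ 2 ∂arcLength b =
      ∑ j ∈ Finset.range N, ∑ w ∈ level b j, ∫ s in (0 : ℝ)..1,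
        Ψ (j + s) * ‖u (edge w s)‖ ^ 2 := by
  have hcongr : ∀ w : TreeEdge b, ∀ s ∈ Ioc (0 : ℝ) 1,
      Ψ (edge w s).height * ‖u (edge w s)‖ ^ 2 = Ψ (w.length + s) * ‖u (edge w s)‖ ^ 2 :=
    fun w s hs => by rw [height_edge w (Ioc_subset_Icc_self hs)]
  obtain ⟨h1, h2⟩ := integral_arcLength (f := fun x => Ψ x.height * ‖u x‖ ^ 2)
    ((hΨm.comp measurable_height).mul (hu.measurable.norm.pow_const 2)) N
    (fun w hw s hs => by simp [hN w hw s (Ioc_subset_Icc_self hs)])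
    (fun w => by
      have h : IntervalIntegrable (fun s => Ψ (w.length + s) * ‖u (edge w s)‖ ^ 2)
          volume 0 1 := by
        refine (hΨ w.length).mul_continuousOn ?_
        rw [uIcc_of_le zero_le_one]
        exact (hu.contDiffOn w).continuousOn.norm.pow 2
      rw [intervalIntegrable_iff_integrableOn_Ioc_of_le zero_le_one] at h ⊢
      exact h.congr_fun (fun s hs => (hcongr w s hs).symm) measurableSet_Ioc)
  refine ⟨h1, h2.trans ?_⟩
  refine Finset.sum_congr rfl fun j _ => Finset.sum_congr rfl fun w hw => ?_
  rw [intervalIntegral.integral_of_le zero_le_one, intervalIntegral.integral_of_le zero_le_one,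
    ← mem_level.mp hw]
  exact setIntegral_congr_fun measurableSet_Ioc (hcongr w)

/-- Boundary terms that match at the vertices telescope over the tree. -/
theorem sum_boundary_eq {g : HomTree b → ℝ} {m₀ m₁ : ℕ → ℝ} (hm : ∀ j, m₁ j = b * m₀ (j + 1))
    (N : ℕ) :
    ∑ j ∈ Finset.range N, ∑ w ∈ level b j, (m₁ j * g (terminal w) - m₀ j * g (initial w)) =
      m₀ N * ∑ w ∈ level b N, g (initial w) - m₀ 0 * g root := by
  have h : ∀ j, ∑ w ∈ level b j, (m₁ j * g (terminal w) - m₀ j * g (initial w)) =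
      m₀ (j + 1) * ∑ w ∈ level b (j + 1), g (initial w)
        - m₀ j * ∑ w ∈ level b j, g (initial w) := by
    intro j
    rw [Finset.sum_sub_distrib, ← Finset.mul_sum, ← Finset.mul_sum, sum_level_succ, hm]
    simp only [initial, Finset.sum_const, Finset.card_univ, Fintype.card_fin, nsmul_eq_mul,
      ← Finset.mul_sum]
    ring
  simp_rw [h]
  rw [Finset.sum_range_sub (fun j => m₀ j * ∑ w ∈ level b j, g (initial w))]
  simp [level_zero, initial]

end HomTree

/-! ### Sufficiency: the Hardy inequality from the ground state. -/

/-- The ground-state slopes match at the vertices: the solutions with values `3 + j` at the level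
`j`, after rescaling by `b ^ (j / 2)`, satisfy the Kirchhoff condition. -/
theorem ground_state_slope_matching {b : ℕ} (hb : 2 ≤ b) {θ : ℝ}
    (hcos : Real.cos θ = 2 * √b / (b + 1)) (hsin : 0 < Real.sin θ) {x : ℝ} (hx : 0 < x) (k : ℝ) :
    sineInterpDeriv θ x ((x + 1) / √b) 1 / sineInterp θ x ((x + 1) / √b) 1
        - k / sineInterp θ x ((x + 1) / √b) 1 ^ 2 =
      b * (sineInterpDeriv θ (x + 1) ((x + 1 + 1) / √b) 0
        / sineInterp θ (x + 1) ((x + 1 + 1) / √b) 0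
        - k / sineInterp θ (x + 1) ((x + 1 + 1) / √b) 0 ^ 2) := by
  have hb0 : (0 : ℝ) < b := by positivity
  have hs : 0 < √(b : ℝ) := Real.sqrt_pos.mpr hb0
  -- In terms of q = √b the identity is rational. The slopes match by (1 + b) cos θ = 2√b and x + (x
  -- + 2) = 2(x + 1); the `k` terms match because the squared vertex values differ by the factor b.
  obtain ⟨q, hq, hq0⟩ : ∃ q : ℝ, √(b : ℝ) = q ∧ 0 < q := ⟨_, rfl, hs⟩
  have hqb : (b : ℝ) = q ^ 2 := by rw [← hq, Real.sq_sqrt hb0.le]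
  simp only [sineInterp_one, sineInterp_zero, sineInterpDeriv_one, sineInterpDeriv_zero]
  rw [hcos, hq, hqb]
  field_simp
  ring

namespace HomTree

variable {b : ℕ}

/-- The Hardy inequality on the tree for weights `Ψ` with linearly growing integrals of
`Ψ(t) (1 + t)²`. -/
theorem exists_hardy_of_linear_bound (hb : 2 ≤ b) {Ψ : ℝ → ℝ} (hΨm : Measurable Ψ)
    (hΨ0 : ∀ t, 0 ≤ Ψ t) {M : ℝ} (hM0 : 0 ≤ M)
    (hint : ∀ r, 0 ≤ r → IntervalIntegrable (fun t => Ψ t * (1 + t) ^ 2) volume 0 r)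
    (hM : ∀ r, 0 ≤ r → ∫ t in (0 : ℝ)..r, Ψ t * (1 + t) ^ 2 ≤ M * (1 + r)) :
    ∃ C : ℝ, 0 < C ∧ ∀ u : HomTree b → ℂ, SmoothBoundedSupport u →
      Integrable (fun x => Ψ x.height * ‖u x‖ ^ 2) (arcLength b) ∧
      ∫ x, Ψ x.height * ‖u x‖ ^ 2 ∂arcLength b ≤
        C * ∫ x, (‖edgeDeriv u x‖ ^ 2 - lambdaB b * ‖u x‖ ^ 2) ∂arcLength b := by
  set θ := Real.arccos (1 / Rb b) with hθ
  have hcos : Real.cos θ = 2 * √b / (b + 1) := cos_arccos_Rb hb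
  have hsin : 0 < Real.sin θ := sin_arccos_Rb_pos hb
  have hθ0 : 0 ≤ θ := arccos_Rb_nonneg b
  have hθ1 : θ ≤ Real.pi / 2 := arccos_Rb_le hb
  have hb2 : (2 : ℝ) ≤ b := by exact_mod_cast hb
  have hb0 : (0 : ℝ) < b := by linarith
  have hq0 : 0 < √(b : ℝ) := Real.sqrt_pos.mpr hb0
  have hqb : √(b : ℝ) ^ 2 = b := Real.sq_sqrt hb0.le
  have hq1 : 1 ≤ √(b : ℝ) := by
    rw [Real.one_le_sqrt]
    linarith
  -- Below, p² ≥ κ(1 + t)². With ε = κ/4, the bound k ≤ (κ/2)(1 + t) gives k²/p² ≤ ε; δ is small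
  -- enough to ensure that bound.
  set κ : ℝ := Real.sin θ ^ 2 / b with hκ
  have hκ0 : 0 < κ := by positivity
  set ε : ℝ := κ / 4 with hε
  have hε0 : 0 < ε := by positivity
  set δ : ℝ := κ / (4 * (M + 1)) with hδ
  have hδ0 : 0 < δ := by positivity
  have hδM : δ * M + ε ≤ κ / 2 := by
    have : δ * M ≤ δ * (M + 1) := by nlinarith
    have h2 : δ * (M + 1) = κ / 4 := by
      rw [hδ]
      field_simp
    rw [hε]
    linarith
  set k : ℝ → ℝ := fun t => δ * (∫ τ in (0 : ℝ)..t, Ψ τ * (1 + τ) ^ 2) + ε * t with hk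
  have hk0 : ∀ t, 0 ≤ t → 0 ≤ k t := fun t ht => by
    have : 0 ≤ ∫ τ in (0 : ℝ)..t, Ψ τ * (1 + τ) ^ 2 :=
      intervalIntegral.integral_nonneg ht fun τ _ => mul_nonneg (hΨ0 τ) (sq_nonneg _)
    simp only [hk]
    positivity
  have hkle : ∀ t, 0 ≤ t → k t ≤ κ / 2 * (1 + t) := fun t ht => by
    have h1 := mul_le_mul_of_nonneg_left (hM t ht) hδ0.le
    have h2 := mul_le_mul_of_nonneg_right hδM (by linarith : 0 ≤ 1 + t)
    simp only [hk]
    nlinarith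
  -- The factor b^(-j/2) is dropped since it cancels in p'/p. The offset 3 is the least one giving a
  -- nonpositive slope at the root for every b ≥ 2.
  set p : ℕ → ℝ → ℝ := fun j => sineInterp θ (3 + j) ((3 + j + 1) / √b) with hp
  set p' : ℕ → ℝ → ℝ := fun j => sineInterpDeriv θ (3 + j) ((3 + j + 1) / √b) with hp'
  have hplow : ∀ j : ℕ, ∀ s ∈ Icc (0 : ℝ) 1, (1 + (j + s)) / √b * Real.sin θ ≤ p j s := by
    intro j s hs
    have hj : (0 : ℝ) ≤ j := j.cast_nonneg
    have hs0 := hs.1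
    refine mul_sin_le_sineInterp hθ0 hθ1 (by positivity) ?_ ?_ hs
    · refine (div_le_self (by positivity) hq1).trans ?_
      linarith [hs.2]
    · exact div_le_div_of_nonneg_right (by linarith [hs.2]) hq0.le
  have hplow2 : ∀ j : ℕ, ∀ s ∈ Icc (0 : ℝ) 1, κ * (1 + (j + s)) ^ 2 ≤ p j s ^ 2 := by
    intro j s hs
    have hs0 := hs.1
    have := pow_le_pow_left₀ (by positivity) (hplow j s hs) 2
    refine le_trans (le_of_eq ?_) this
    rw [mul_pow, div_pow, hqb, hκ]
    ring
  have hppos : ∀ j : ℕ, ∀ s ∈ Icc (0 : ℝ) 1, 0 < p j s := fun j s hs => by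
    have hs0 := hs.1
    exact lt_of_lt_of_le (by positivity) (hplow j s hs)
  -- 49 = 7², from p ≤ 7 + 2j ≤ 7(1 + j + s).
  have hpup : ∀ j : ℕ, ∀ s ∈ Icc (0 : ℝ) 1, p j s ^ 2 ≤ 49 * (1 + (j + s)) ^ 2 := by
    intro j s hs
    have hj : (0 : ℝ) ≤ j := j.cast_nonneg
    have h1 : p j s ≤ (3 + j) + (3 + j + 1) / √b := sineInterp_le (by positivity) (by positivity) s
    have h2 : ((3 : ℝ) + j + 1) / √b ≤ 3 + j + 1 := div_le_self (by positivity) hq1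
    have h3 : p j s ≤ 7 * (1 + (j + s)) := by nlinarith [hs.1]
    have := pow_le_pow_left₀ (hppos j s hs).le h3 2
    nlinarith
  have hshift : ∀ j : ℕ, IntervalIntegrable
      (fun s => Ψ (j + s) * (1 + (j + s)) ^ 2) volume 0 1 := by
    intro j
    have h1 : IntervalIntegrable (fun t => Ψ t * (1 + t) ^ 2) volume j (j + 1) :=
      (hint j (by positivity)).symm.trans (hint (j + 1) (by positivity))
    simpa using h1.comp_add_left (j : ℝ)
  have hΨs : ∀ j : ℕ, IntervalIntegrable (fun s => Ψ (j + s)) volume 0 1 := by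
    intro j
    have hc : ContinuousOn (fun s : ℝ => (((1 : ℝ) + (j + s)) ^ 2)⁻¹) (uIcc 0 1) := by
      rw [uIcc_of_le zero_le_one]
      refine ContinuousOn.inv₀ (by fun_prop) fun s hs => ?_
      have := hs.1
      positivity
    have := (hshift j).mul_continuousOn hc
    rw [intervalIntegrable_iff_integrableOn_Ioc_of_le zero_le_one] at this ⊢
    refine this.congr_fun (fun s hs => ?_) measurableSet_Ioc
    have := hs.1
    simp only
    field_simp
  have hksplit : ∀ j : ℕ, ∀ s ∈ Icc (0 : ℝ) 1, k (j + s) = k j +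
      ∫ t in (0 : ℝ)..s, (δ * (Ψ (j + t) * (1 + (j + t)) ^ 2) + ε) := by
    intro j s hs
    have hs0 := hs.1
    have hsub : IntervalIntegrable (fun s => Ψ (j + s) * (1 + (j + s)) ^ 2) volume 0 s :=
      (hshift j).mono_set (by
        rw [uIcc_of_le hs.1, uIcc_of_le zero_le_one]
        exact Icc_subset_Icc_right hs.2)
    rw [intervalIntegral.integral_add (hsub.const_mul δ) intervalIntegrable_const,
      intervalIntegral.integral_const_mul,
      intervalIntegral.integral_comp_add_left (fun t => Ψ t * (1 + t) ^ 2) (j : ℝ)]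
    have h := intervalIntegral.integral_add_adjacent_intervals (hint j (by positivity))
      ((hint j (by positivity)).symm.trans (hint (j + s) (by positivity)))
    simp only [hk, ← h, add_zero, intervalIntegral.integral_const, smul_eq_mul, sub_zero]
    ring
  refine ⟨49 / δ, by positivity, fun u hu => ?_⟩
  obtain ⟨N, hN⟩ := hu.exists_level
  obtain ⟨hI, hIeq⟩ := hu.integral_potential hN hΨm hΨs
  refine ⟨hI, ?_⟩
  rw [hu.integral_energy hN, hIeq]
  set m₀ : ℕ → ℝ := fun j => p' j 0 / p j 0 - k j / p j 0 ^ 2 with hm₀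
  set m₁ : ℕ → ℝ := fun j => p' j 1 / p j 1 - k (j + 1) / p j 1 ^ 2 with hm₁
  have hm : ∀ j, m₁ j = b * m₀ (j + 1) := by
    intro j
    have h := ground_state_slope_matching hb hcos hsin (x := 3 + j) (by positivity) (k (j + 1))
    simp only [hm₀, hm₁, hp, hp', Nat.cast_add, Nat.cast_one]
    rw [← add_assoc (3 : ℝ) j 1]
    exact h
  have hedge : ∀ j : ℕ, ∀ w ∈ level b j,
      m₁ j * ‖u (terminal w)‖ ^ 2 - m₀ j * ‖u (initial w)‖ ^ 2 ≤
      (∫ s in (0 : ℝ)..1, (‖derivWithin (fun t => u (edge w t)) (Icc 0 1) s‖ ^ 2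
        - lambdaB b * ‖u (edge w s)‖ ^ 2))
        - δ / 49 * ∫ s in (0 : ℝ)..1, Ψ (j + s) * ‖u (edge w s)‖ ^ 2 := by
    intro j w _
    have h := boundary_le_integral_of_riccati (hu.contDiffOn w) (p := p j) (p' := p' j) (θ := θ)
      (hasDerivAt_sineInterp _ _ _) (hasDerivAt_sineInterpDeriv _ _ _) (hppos j)
      -- In `G` = k' the first summand absorbs V p², which is why V carries 1/49, and the summand ε
      -- absorbs k²/p².
      (G := fun t => δ * (Ψ (j + t) * (1 + (j + t)) ^ 2) + ε)
      (V := fun s => δ / 49 * Ψ (j + s)) (K := fun s => k (j + s)) (K₀ := k j)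
      (((hshift j).const_mul δ).add intervalIntegrable_const) ((hΨs j).const_mul _)
      (hksplit j) (by
        intro s hs
        have hsI := Ioo_subset_Icc_self hs
        have hs0 := hsI.1
        have hj : (0 : ℝ) ≤ j := j.cast_nonneg
        have h1 : δ / 49 * Ψ (j + s) * p j s ^ 2 ≤ δ * (Ψ (j + s) * (1 + (j + s)) ^ 2) := by
          have := mul_le_mul_of_nonneg_left (hpup j s hsI)
            (mul_nonneg (by positivity : 0 ≤ δ / 49) (hΨ0 (j + s)))
          linarith
        have h2 : k (j + s) ^ 2 / p j s ^ 2 ≤ ε := by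
          rw [div_le_iff₀ (pow_pos (hppos j s hsI) 2)]
          have h3 := pow_le_pow_left₀ (hk0 (j + s) (by positivity)) (hkle (j + s) (by positivity)) 2
          have h4 := mul_le_mul_of_nonneg_left (hplow2 j s hsI) hε0.le
          refine h3.trans (le_trans (le_of_eq ?_) h4)
          rw [hε]
          ring
        exact add_le_add h1 h2)
    simp only [edge_one, edge_zero, add_zero] at h
    refine h.trans (le_of_eq ?_)
    rw [← intervalIntegral.integral_const_mul, ← intervalIntegral.integral_sub]
    · refine intervalIntegral.integral_congr fun s _ => ?_
      simp only [lambdaB, ← hθ]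
      ring
    · refine ContinuousOn.intervalIntegrable ?_
      rw [uIcc_of_le zero_le_one]
      exact ((continuousOn_derivWithin_Icc (hu.contDiffOn w)).norm.pow 2).sub
        (continuousOn_const.mul ((hu.contDiffOn w).continuousOn.norm.pow 2))
    · refine ((hΨs j).mul_continuousOn ?_).const_mul _
      rw [uIcc_of_le zero_le_one]
      exact (hu.contDiffOn w).continuousOn.norm.pow 2
  have hsum := Finset.sum_le_sum fun j (_ : j ∈ Finset.range N) => Finset.sum_le_sum (hedge j)
  rw [sum_boundary_eq (g := fun x => ‖u x‖ ^ 2) hm N] at hsum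
  have hzero : ∑ w ∈ level b N, ‖u (initial w)‖ ^ 2 = 0 := by
    refine Finset.sum_eq_zero fun w hw => ?_
    rw [← edge_zero, hN w (mem_level.mp hw).ge 0 (by simp)]
    simp
  -- The root value of u is free, so this sign is needed; it amounts to 4(b + 1) ≤ 6b, that is b ≥
  -- 2.
  have hm₀0 : m₀ 0 ≤ 0 := by
    have hk00 : k 0 = 0 := by simp [hk]
    simp only [hm₀, hp, hp', Nat.cast_zero, hk00, zero_div, sub_zero, sineInterpDeriv_zero,
      sineInterp_zero, add_zero]
    refine div_nonpos_of_nonpos_of_nonneg (mul_nonpos_of_nonneg_of_nonpos hθ0 ?_) (by positivity)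
    rw [hcos, sub_nonpos, div_le_iff₀ hq0]
    have : 3 * (2 * √(b : ℝ) / (b + 1)) * √b = 6 * b / (b + 1) := by
      calc _ = 6 * √(b : ℝ) ^ 2 / (b + 1) := by ring
        _ = _ := by rw [hqb]
    rw [this, le_div_iff₀ (by positivity)]
    linarith
  rw [hzero, mul_zero, zero_sub] at hsum
  have hnn : 0 ≤ -(m₀ 0 * ‖u root‖ ^ 2) := by
    have := mul_nonneg (neg_nonneg.mpr hm₀0) (sq_nonneg ‖u root‖)
    linarith
  have hfin := hnn.trans hsum
  simp only [Finset.sum_sub_distrib, ← Finset.mul_sum] at hfin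
  rw [div_mul_eq_mul_div, le_div_iff₀ hδ0]
  linarith

end HomTree

/-! ### Necessity: radial test functions. -/

/-- For p'' = -θ² p the integrand is (p p')', so only boundary terms remain. -/
theorem integral_sineInterp_energy (θ α β : ℝ) :
    ∫ s in (0 : ℝ)..1, (sineInterpDeriv θ α β s ^ 2 - θ ^ 2 * sineInterp θ α β s ^ 2) =
      θ * Real.sin θ * ((α ^ 2 + β ^ 2) * Real.cos θ - 2 * α * β) := by
  have hd : ∀ s ∈ uIcc (0 : ℝ) 1,
      HasDerivAt (fun s => sineInterp θ α β s * sineInterpDeriv θ α β s)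
        (sineInterpDeriv θ α β s ^ 2 - θ ^ 2 * sineInterp θ α β s ^ 2) s := fun s _ =>
    ((hasDerivAt_sineInterp θ α β s).fun_mul
      (hasDerivAt_sineInterpDeriv θ α β s)).congr_deriv (by ring)
  have hc : Continuous fun s =>
      sineInterpDeriv θ α β s ^ 2 - θ ^ 2 * sineInterp θ α β s ^ 2 := by
    unfold sineInterp sineInterpDeriv
    fun_prop
  rw [intervalIntegral.integral_eq_sub_of_hasDerivAt hd (hc.intervalIntegrable _ _)]
  simp
  ring

theorem lintegral_Ioc_natCast (f : ℝ → ℝ≥0∞) (n : ℕ) :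
    ∫⁻ t in Ioc (0 : ℝ) n, f t = ∑ j ∈ Finset.range n, ∫⁻ s in Ioc (0 : ℝ) 1, f (j + s) := by
  induction n with
  | zero => simp
  | succ n ih =>
    rw [Finset.sum_range_succ, ← ih,
      ← Ioc_union_Ioc_eq_Ioc (b := (n : ℝ)) (by positivity) (by simp),
      lintegral_union measurableSet_Ioc (Ioc_disjoint_Ioc_of_le le_rfl)]
    congr 1
    rw [← (measurePreserving_add_left volume (n : ℝ)).setLIntegral_comp_preimage_emb
      (measurableEmbedding_addLeft (n : ℝ))]
    simp

namespace HomTree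

variable {b : ℕ}

/-- The radial function with the vertex values `a j * sin θ / b ^ (j / 2)` that solves
`u'' = -θ² u` on the edges. -/
noncomputable def radialInterp (b : ℕ) (θ : ℝ) (a : ℕ → ℝ) : HomTree b → ℂ
  | root => ((a 0 * Real.sin θ : ℝ) : ℂ)
  | pt w s => ((sineInterp θ (a w.length / √b ^ w.length)
      (a (w.length + 1) / √b ^ (w.length + 1)) s : ℝ) : ℂ)

theorem radialInterp_edge (θ : ℝ) (a : ℕ → ℝ) (w : TreeEdge b) {s : ℝ}
    (hs : s ∈ Icc (0 : ℝ) 1) :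
    radialInterp b θ a (edge w s) = ((sineInterp θ (a w.length / √b ^ w.length)
      (a (w.length + 1) / √b ^ (w.length + 1)) s : ℝ) : ℂ) := by
  rcases hs.1.eq_or_lt with rfl | h
  · rw [edge_zero]
    cases w with
    | nil => simp [initial, radialInterp]
    | cons i w => simp [initial, terminal, radialInterp]
  · rw [edge_of_mem w ⟨h, hs.2⟩, radialInterp]

theorem smoothBoundedSupport_radialInterp (θ : ℝ) {a : ℕ → ℝ} {N : ℕ}
    (ha : ∀ j, N ≤ j → a j = 0) : SmoothBoundedSupport (radialInterp b θ a) := by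
  refine ⟨fun w => ?_, N + 1, fun x hx => ?_⟩
  · refine ContDiffOn.congr ?_ fun s hs => radialInterp_edge θ a w hs
    exact (Complex.ofRealCLM.contDiff.comp (contDiff_sineInterp _ _ _)).contDiffOn
  · cases x with
    | root =>
      simp only [height] at hx
      have : (0 : ℝ) ≤ N := N.cast_nonneg
      linarith
    | pt w s =>
      simp only [height] at hx
      have h : (N : ℝ) < w.length := by linarith [s.2.2]
      have h' : N < w.length := by exact_mod_cast h
      simp [radialInterp, ha _ h'.le, ha _ (h'.le.trans (Nat.le_succ _)), sineInterp]

/-- The b^j edges of a level cancel the squared scaling b^(-j). At the critical cos θ, the quadratic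
form of a level is a perfect square plus a difference that telescopes to the root term. -/
theorem integral_energy_radialInterp (hb : 2 ≤ b) {a : ℕ → ℝ} {N : ℕ}
    (ha : ∀ j, N ≤ j → a j = 0) :
    ∫ x, (‖edgeDeriv (radialInterp b (Real.arccos (1 / Rb b)) a) x‖ ^ 2
      - lambdaB b * ‖radialInterp b (Real.arccos (1 / Rb b)) a x‖ ^ 2) ∂arcLength b =
    Real.arccos (1 / Rb b) * Real.sin (Real.arccos (1 / Rb b)) / √b *
      (∑ j ∈ Finset.range N, (a j - a (j + 1)) ^ 2 + (b - 1) / (b + 1) * a 0 ^ 2) := by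
  set θ := Real.arccos (1 / Rb b) with hθ
  have hcos : Real.cos θ = 2 * √b / (b + 1) := cos_arccos_Rb hb
  have hb0 : (0 : ℝ) < b := by positivity
  have hu := smoothBoundedSupport_radialInterp (b := b) θ ha
  have hN : ∀ w : TreeEdge b, N ≤ w.length → ∀ s ∈ Icc (0 : ℝ) 1,
      radialInterp b θ a (edge w s) = 0 := fun w hw s hs => by
    simp [radialInterp_edge θ a w hs, ha _ hw, ha _ (hw.trans (Nat.le_succ _)), sineInterp]
  rw [hu.integral_energy hN]
  have hedge : ∀ j : ℕ, ∑ w ∈ level b j, ∫ s in (0 : ℝ)..1,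
      (‖derivWithin (fun t => radialInterp b θ a (edge w t)) (Icc 0 1) s‖ ^ 2
        - lambdaB b * ‖radialInterp b θ a (edge w s)‖ ^ 2) =
      θ * Real.sin θ / √b * ((a j - a (j + 1)) ^ 2
        + (b - 1) / (b + 1) * (a j ^ 2 - a (j + 1) ^ 2)) := by
    intro j
    have h : ∀ w ∈ level b j, ∫ s in (0 : ℝ)..1,
        (‖derivWithin (fun t => radialInterp b θ a (edge w t)) (Icc 0 1) s‖ ^ 2
          - lambdaB b * ‖radialInterp b θ a (edge w s)‖ ^ 2) =
        θ * Real.sin θ * (((a j / √b ^ j) ^ 2 + (a (j + 1) / √b ^ (j + 1)) ^ 2) * Real.cos θ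
          - 2 * (a j / √b ^ j) * (a (j + 1) / √b ^ (j + 1))) := by
      intro w hw
      rw [← integral_sineInterp_energy]
      refine intervalIntegral.integral_congr fun s hs => ?_
      rw [uIcc_of_le zero_le_one] at hs
      have hd := ((hasDerivAt_sineInterp θ (a j / √b ^ j) (a (j + 1) / √b ^ (j + 1)) s).ofReal_comp
        ).hasDerivWithinAt (s := Icc (0 : ℝ) 1)
      have he : ∀ t ∈ Icc (0 : ℝ) 1, radialInterp b θ a (edge w t) =
          ((sineInterp θ (a j / √b ^ j) (a (j + 1) / √b ^ (j + 1)) t : ℝ) : ℂ) := fun t ht => by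
        rw [radialInterp_edge θ a w ht, mem_level.mp hw]
      rw [derivWithin_congr he (he s hs), hd.derivWithin (uniqueDiffOn_Icc one_pos s hs),
        he s hs, Complex.norm_real, Complex.norm_real, Real.norm_eq_abs, Real.norm_eq_abs,
        sq_abs, sq_abs, lambdaB]
    rw [Finset.sum_congr rfl h, Finset.sum_const, card_level, hcos, nsmul_eq_mul]
    obtain ⟨q, hq, hq0⟩ : ∃ q : ℝ, √(b : ℝ) = q ∧ 0 < q := ⟨_, rfl, Real.sqrt_pos.mpr hb0⟩
    have hqb : (b : ℝ) = q ^ 2 := by rw [← hq, Real.sq_sqrt hb0.le]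
    push_cast
    rw [hq, hqb]
    field_simp
    ring
  simp_rw [hedge, ← Finset.mul_sum, Finset.sum_add_distrib, ← Finset.mul_sum,
    Finset.sum_range_sub', ha N le_rfl]
  ring

end HomTree

/-- The values of a tent that rises with slope one from `1` at `0` to `n + 1` at `n` and
then descends to `0`. -/
def tent (n j : ℕ) : ℝ := max 0 (min (1 + j) (2 * n + 1 - j))

theorem tent_eq_zero {n j : ℕ} (h : 2 * n + 1 ≤ j) : tent n j = 0 := by
  have h' : (2 * n + 1 : ℝ) ≤ j := by exact_mod_cast h
  exact max_eq_left ((min_le_right _ _).trans (by linarith))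

theorem tent_zero (n : ℕ) : tent n 0 = 1 := by
  have h : (0 : ℝ) ≤ n := n.cast_nonneg
  simp [tent]

theorem le_tent {n j : ℕ} (h : j ≤ n) : (1 + j : ℝ) ≤ tent n j := by
  have h' : (j : ℝ) ≤ n := by exact_mod_cast h
  exact (le_min le_rfl (by linarith)).trans (le_max_right _ _)

theorem le_tent_succ {n j : ℕ} (h : j < n) : (1 + j : ℝ) ≤ tent n (j + 1) := by
  have := le_tent (Nat.succ_le_of_lt h)
  push_cast at this
  linarith

theorem sq_tent_sub_le (n j : ℕ) : (tent n j - tent n (j + 1)) ^ 2 ≤ 1 := by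
  rw [sq_le_one_iff_abs_le_one, tent, tent]
  refine (abs_max_sub_max_le_max _ _ _ _).trans (max_le (by simp) ?_)
  refine (abs_min_sub_min_le_max _ _ _ _).trans (max_le ?_ ?_) <;> push_cast <;>
    rw [abs_le] <;> constructor <;> linarith

namespace HomTree

variable {b : ℕ}

/-- Each tent is tested in the Hardy inequality: unit steps keep the energy linear in n, and the
rising half supplies the weight (1 + t)². -/
theorem lintegral_le_of_hardy (hb : 2 ≤ b) {Ψ : ℝ → ℝ} (hΨm : Measurable Ψ)
    (hΨ0 : ∀ t, 0 ≤ Ψ t) {C : ℝ} (hC : 0 < C)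
    (h : ∀ u : HomTree b → ℂ, SmoothBoundedSupport u →
      Integrable (fun x => Ψ x.height * ‖u x‖ ^ 2) (arcLength b) ∧
      ∫ x, Ψ x.height * ‖u x‖ ^ 2 ∂arcLength b ≤
        C * ∫ x, (‖edgeDeriv u x‖ ^ 2 - lambdaB b * ‖u x‖ ^ 2) ∂arcLength b) :
    ∃ D : ℝ, ∀ n : ℕ, ∫⁻ t in Ioc (0 : ℝ) n, ENNReal.ofReal (Ψ t * (1 + t) ^ 2) ≤
      ENNReal.ofReal (D * (n + 1)) := by
  set θ := Real.arccos (1 / Rb b) with hθ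
  have hsin : 0 < Real.sin θ := sin_arccos_Rb_pos hb
  have hθ0 : 0 ≤ θ := arccos_Rb_nonneg b
  have hθ1 : θ ≤ Real.pi / 2 := arccos_Rb_le hb
  have hb2 : (2 : ℝ) ≤ b := by exact_mod_cast hb
  have hb0 : (0 : ℝ) < b := by linarith
  have hq0 : 0 < √(b : ℝ) := Real.sqrt_pos.mpr hb0
  have hq1 : 1 ≤ √(b : ℝ) := by
    rw [Real.one_le_sqrt]
    linarith
  -- The 4 comes from 1 + j + s ≤ 2(1 + j), the b from the scaling √b^(j + 1) at the far end of a
  -- level-j edge.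
  set κ : ℝ := Real.sin θ ^ 2 / (4 * b) with hκ
  have hκ0 : 0 < κ := by positivity
  set E : ℝ := θ * Real.sin θ / √b with hE
  have hE0 : 0 ≤ E := by positivity
  refine ⟨2 * C * E / κ, fun n => ?_⟩
  set u := radialInterp b θ (tent n) with hu
  have htent : ∀ j, 2 * n + 1 ≤ j → tent n j = 0 := fun j hj => tent_eq_zero hj
  have hsm : SmoothBoundedSupport u := smoothBoundedSupport_radialInterp θ htent
  obtain ⟨hI, hle⟩ := h u hsm
  have henergy : ∫ x, (‖edgeDeriv u x‖ ^ 2 - lambdaB b * ‖u x‖ ^ 2) ∂arcLength b ≤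
      E * (2 * (n + 1)) := by
    rw [hu, hθ, integral_energy_radialInterp hb htent, ← hθ, ← hE, tent_zero]
    refine mul_le_mul_of_nonneg_left ?_ hE0
    have h1 : ∑ j ∈ Finset.range (2 * n + 1), (tent n j - tent n (j + 1)) ^ 2 ≤
        ∑ _j ∈ Finset.range (2 * n + 1), (1 : ℝ) :=
      Finset.sum_le_sum fun j _ => sq_tent_sub_le n j
    have h2 : ((b : ℝ) - 1) / (b + 1) ≤ 1 := by
      rw [div_le_one (by positivity)]
      linarith
    simp at h1
    linarith
  have hlow : ENNReal.ofReal κ * ∫⁻ t in Ioc (0 : ℝ) n, ENNReal.ofReal (Ψ t * (1 + t) ^ 2) ≤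
      ∫⁻ x, ENNReal.ofReal (Ψ x.height * ‖u x‖ ^ 2) ∂arcLength b := by
    refine le_trans ?_ (sum_lintegral_le_lintegral_arcLength
      ((hΨm.comp measurable_height).mul (hsm.measurable.norm.pow_const 2)).ennreal_ofReal n)
    rw [lintegral_Ioc_natCast, Finset.mul_sum]
    refine Finset.sum_le_sum fun j hj => ?_
    have hjn : j < n := Finset.mem_range.mp hj
    have hw : ∀ w ∈ level b j, (ENNReal.ofReal (κ / b ^ j) *
        ∫⁻ s in Ioc (0 : ℝ) 1, ENNReal.ofReal (Ψ (j + s) * (1 + (j + s)) ^ 2)) ≤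
        ∫⁻ s in Ioc (0 : ℝ) 1, ENNReal.ofReal (Ψ (edge w s).height * ‖u (edge w s)‖ ^ 2) := by
      intro w hw
      have hwj := mem_level.mp hw
      rw [← lintegral_const_mul' _ _ ENNReal.ofReal_ne_top]
      refine setLIntegral_mono' measurableSet_Ioc fun s hs => ?_
      have hsI := Ioc_subset_Icc_self hs
      rw [← ENNReal.ofReal_mul (by positivity)]
      refine ENNReal.ofReal_le_ofReal ?_
      rw [height_edge w hsI, hu, radialInterp_edge θ _ w hsI, hwj, Complex.norm_real,
        Real.norm_eq_abs, sq_abs]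
      have hc : (1 + (j : ℝ)) / √b ^ (j + 1) * Real.sin θ ≤
          sineInterp θ (tent n j / √b ^ j) (tent n (j + 1) / √b ^ (j + 1)) s := by
        refine mul_sin_le_sineInterp hθ0 hθ1 (by positivity) ?_ ?_ hsI
        · exact div_le_div₀ (le_trans (by positivity) (le_tent hjn.le)) (le_tent hjn.le)
            (by positivity) (pow_le_pow_right₀ hq1 (Nat.le_succ j))
        · exact div_le_div_of_nonneg_right (le_tent_succ hjn) (by positivity)
      have hc2 := pow_le_pow_left₀ (by positivity) hc 2
      rw [mul_comm (κ / _), mul_assoc]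
      refine mul_le_mul_of_nonneg_left (le_trans ?_ hc2) (hΨ0 _)
      have hpow : (√(b : ℝ) ^ (j + 1)) ^ 2 = b ^ j * b := by
        rw [← pow_mul, mul_comm, pow_mul, Real.sq_sqrt hb0.le, pow_succ]
      rw [mul_pow, div_pow, hpow, hκ]
      have hs4 : (1 + (j + s)) ^ 2 ≤ 4 * (1 + (j : ℝ)) ^ 2 := by
        have hj : (0 : ℝ) ≤ j := j.cast_nonneg
        nlinarith [hs.1, hs.2]
      calc (1 + (j + s)) ^ 2 * (Real.sin θ ^ 2 / (4 * b) / b ^ j)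
          ≤ 4 * (1 + (j : ℝ)) ^ 2 * (Real.sin θ ^ 2 / (4 * b) / b ^ j) :=
            mul_le_mul_of_nonneg_right hs4 (by positivity)
        _ = _ := by field_simp
    refine le_trans (le_of_eq ?_) (Finset.sum_le_sum hw)
    rw [Finset.sum_const, card_level, nsmul_eq_mul, ← mul_assoc]
    congr 1
    rw [← ENNReal.ofReal_natCast, ← ENNReal.ofReal_mul (by positivity)]
    congr 1
    push_cast
    field_simp
  -- Integrability is essential here: a divergent Bochner integral would be 0 and carry no
  -- information.
  rw [← ofReal_integral_eq_lintegral_ofReal hI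
    (ae_of_all _ fun x => mul_nonneg (hΨ0 _) (sq_nonneg _))] at hlow
  have hup := hlow.trans (ENNReal.ofReal_le_ofReal
    (hle.trans (mul_le_mul_of_nonneg_left henergy hC.le)))
  rw [mul_comm, ← ENNReal.le_div_iff_mul_le (by simp [hκ0]) (by simp),
    ← ENNReal.ofReal_div_of_pos hκ0] at hup
  refine hup.trans (ENNReal.ofReal_le_ofReal (le_of_eq ?_))
  ring

end HomTree

/-! ### The equivalence. -/

theorem mainTheorem2 (b : ℕ) (hb : 2 ≤ b) (ψ : ℝ → ℝ)
    (hψ_meas : Measurable (fun t : Set.Ioi (0 : ℝ) => ψ t))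
    (hψ_nonneg : ∀ t : ℝ, 0 < t → 0 ≤ ψ t) :
    (∃ C : ℝ, 0 < C ∧ ∀ u : HomTree b → ℂ, HomTree.SmoothBoundedSupport u →
      MeasureTheory.Integrable (fun x => ψ x.height * ‖u x‖ ^ 2) (HomTree.arcLength b) ∧
      ∫ x, ψ x.height * ‖u x‖ ^ 2 ∂(HomTree.arcLength b) ≤
        C * ∫ x, (‖HomTree.edgeDeriv u x‖ ^ 2 - lambdaB b * ‖u x‖ ^ 2) ∂(HomTree.arcLength b)) ↔
    (⨆ (r : ℝ) (_ : 0 < r), (ENNReal.ofReal (1 + r))⁻¹ *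
      ∫⁻ t in Set.Ioc (0 : ℝ) r, ENNReal.ofReal (ψ t * (1 + t) ^ 2)) < ⊤ := by
  -- Nothing is known of `ψ` outside (0, ∞). Extension by zero gives a measurable nonnegative
  -- function and alters the integrand only at the root, a null set.
  set Ψ : ℝ → ℝ := (Ioi (0 : ℝ)).indicator ψ with hΨ
  have hΨm : Measurable Ψ := by
    refine measurable_of_restrict_of_restrict_compl (measurableSet_Ioi (a := (0 : ℝ))) ?_ ?_
    · convert hψ_meas using 1
      funext t
      simp [hΨ]
    · convert (measurable_const : Measurable fun _ : ((Ioi (0 : ℝ))ᶜ : Set ℝ) => (0 : ℝ)) using 1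
      funext t
      simp [hΨ, indicator_of_notMem t.2]
  have hΨ0 : ∀ t, 0 ≤ Ψ t := fun t => indicator_nonneg (fun t ht => hψ_nonneg t ht) t
  have hΨeq : ∀ t, 0 < t → Ψ t = ψ t := fun t ht => indicator_of_mem (mem_Ioi.mpr ht) ψ
  have hae : ∀ u : HomTree b → ℂ, (fun x => ψ x.height * ‖u x‖ ^ 2) =ᵐ[HomTree.arcLength b]
      fun x => Ψ x.height * ‖u x‖ ^ 2 := by
    intro u
    have hpos : ∀ᵐ x ∂HomTree.arcLength b, 0 < x.height := by
      refine HomTree.ae_arcLength (measurableSet_lt measurable_const HomTree.measurable_height) ?_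
      intro w s hs
      rw [HomTree.height_edge w (Ioc_subset_Icc_self hs)]
      have := hs.1
      positivity
    filter_upwards [hpos] with x hx
    rw [hΨeq _ hx]
  have hlint : ∀ r : ℝ, ∫⁻ t in Ioc (0 : ℝ) r, ENNReal.ofReal (ψ t * (1 + t) ^ 2) =
      ∫⁻ t in Ioc (0 : ℝ) r, ENNReal.ofReal (Ψ t * (1 + t) ^ 2) := fun r =>
    setLIntegral_congr_fun measurableSet_Ioc fun t ht => by simp only [hΨeq t ht.1]
  simp_rw [integrable_congr (hae _), integral_congr_ae (hae _), hlint]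
  constructor
  · rintro ⟨C, hC, h⟩
    obtain ⟨D, hD⟩ := HomTree.lintegral_le_of_hardy hb hΨm hΨ0 hC h
    refine lt_of_le_of_lt (iSup₂_le fun r hr => ?_)
      (ENNReal.ofReal_lt_top (r := 2 * |D|))
    -- Rounding r up to an integer costs at most a factor 2.
    have hn : (⌈r⌉₊ : ℝ) + 1 ≤ 2 * (1 + r) := by linarith [Nat.ceil_lt_add_one hr.le]
    have h1 : ∫⁻ t in Ioc (0 : ℝ) r, ENNReal.ofReal (Ψ t * (1 + t) ^ 2) ≤
        ENNReal.ofReal (2 * |D| * (1 + r)) := by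
      refine (lintegral_mono_set (Ioc_subset_Ioc_right (Nat.le_ceil r))).trans
        ((hD ⌈r⌉₊).trans (ENNReal.ofReal_le_ofReal ?_))
      have h2 := mul_le_mul_of_nonneg_right (le_abs_self D) (by positivity : 0 ≤ (⌈r⌉₊ : ℝ) + 1)
      have h3 := mul_le_mul_of_nonneg_left hn (abs_nonneg D)
      linarith
    rw [mul_comm, ← div_eq_mul_inv]
    refine ENNReal.div_le_of_le_mul ?_
    rwa [← ENNReal.ofReal_mul (by positivity)]
  · intro hfin
    obtain ⟨M, hM⟩ : ∃ M : ℝ≥0∞, M = ⨆ (r : ℝ) (_ : 0 < r), (ENNReal.ofReal (1 + r))⁻¹ *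
      ∫⁻ t in Ioc (0 : ℝ) r, ENNReal.ofReal (Ψ t * (1 + t) ^ 2) := ⟨_, rfl⟩
    rw [← hM] at hfin
    have hle : ∀ r : ℝ, 0 ≤ r → ∫⁻ t in Ioc (0 : ℝ) r, ENNReal.ofReal (Ψ t * (1 + t) ^ 2) ≤
        ENNReal.ofReal (M.toReal * (1 + r)) := by
      intro r hr
      rcases hr.eq_or_lt with rfl | hr
      · simp
      · have h1 : (ENNReal.ofReal (1 + r))⁻¹ *
            ∫⁻ t in Ioc (0 : ℝ) r, ENNReal.ofReal (Ψ t * (1 + t) ^ 2) ≤ M := by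
          rw [hM]
          exact le_iSup₂_of_le r hr le_rfl
        rw [mul_comm, ← div_eq_mul_inv, ENNReal.div_le_iff (by simp; linarith) (by simp)] at h1
        rwa [ENNReal.ofReal_mul ENNReal.toReal_nonneg, ENNReal.ofReal_toReal hfin.ne]
    have hnn : ∀ t, 0 ≤ Ψ t * (1 + t) ^ 2 := fun t => mul_nonneg (hΨ0 t) (sq_nonneg _)
    have hmeas : Measurable fun t => Ψ t * (1 + t) ^ 2 := hΨm.mul (by fun_prop)
    refine HomTree.exists_hardy_of_linear_bound hb hΨm hΨ0 (M := M.toReal) ENNReal.toReal_nonneg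
      (fun r hr => ?_) (fun r hr => ?_)
    · rw [intervalIntegrable_iff_integrableOn_Ioc_of_le hr]
      refine ⟨hmeas.aestronglyMeasurable, ?_⟩
      rw [hasFiniteIntegral_iff_ofReal (ae_of_all _ hnn)]
      exact (hle r hr).trans_lt ENNReal.ofReal_lt_top
    · rw [intervalIntegral.integral_of_le hr, integral_eq_lintegral_of_nonneg_ae (ae_of_all _ hnn)
        hmeas.aestronglyMeasurable]
      exact ENNReal.toReal_le_of_le_ofReal (by positivity) (hle r hr)
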